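/- Let $q$ be a prime power, let $n=2m-1$, and let $\mathrm{PG}(n,q)$ be the projective space whose elements are the subspaces $U$ of $V=\mathbb F_q^{\,n+1}$ with $0\ne U\ne V$. A flag is a set of pairwise incident subspaces; its type is the set of vector space dimensions of its members. Two maximal flags are opposite if there is a basis $b_1,\dots,b_{n+1}$ of $V$ such that one consists of the spaces $\langle b_1,\dots,b_k\rangle$ and the other of the spaces $\langle b_{n+1},\dots,b_{n+2-k}\rangle$, $1\le k\le n$. Two flags of types $J$ and $K$ are opposite if $K=\{n+1-j : j\in J\}$ and they can be extended to two opposite maximal flags. For a self-opposite type $J=\{n+1-j: j\in J\}$, an EKR-set of flags of type $J$ is a set of flags of type $J$, no two of which (equal or not) are opposite. Let $J\subseteq\{1,\dots,n\}$ be a self-opposite type with $m\in J$. Let $C$ be either (i) the set of all flags of type $J$ whose $m$-dimensional member contains a fixed point ($1$-dimensional subspace) $P$, or (ii) the set of all flags of type $J$ whose $m$-dimensional member is contained in a fixed hyperplane ($n$-dimensional subspace) $H$. Then $C$ is an EKR-set of flags of type $J$, and $$|C|=\frac{v}{1+q^{(n+1)/2}},$$ where $v$ is the total number of flags of type $J$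 in $\mathrm{PG}(n,q)$. -/

import Mathlib

/-- The coordinate space `K^(n+1)`, whose subspaces are the elements of `PG(n,K)`. -/
abbrev PGSpace (n : ℕ) (K : Type*) : Type _ := Fin (n + 1) → K

/-- A flag of `PG(n,K)`: a set of pairwise incident, nonzero proper subspaces of `K^(n+1)`. -/
@[ext]
structure PGFlag (n : ℕ) (K : Type*) [Field K] where
  spaces : Set (Submodule K (PGSpace n K))
  incident : ∀ U ∈ spaces, ∀ W ∈ spaces, U ≤ W ∨ W ≤ U
  ne_bot : ∀ U ∈ spaces, U ≠ ⊥
  ne_top : ∀ U ∈ spaces, U ≠ ⊤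

namespace PGFlag

variable {n : ℕ} {K : Type*} [Field K]

/-- The type of a flag: the set of vector space dimensions of its members. -/
noncomputable def type (F : PGFlag n K) : Set ℕ :=
  {k | ∃ U ∈ F.spaces, Module.finrank K U = k}

/-- The image `g F` of a flag under an element `g` of `GL(n+1,K)`. Scalars fix every subspace, so
this is the action of `PGL(n+1,K)` on flags. -/
def map (g : PGSpace n K ≃ₗ[K] PGSpace n K) (F : PGFlag n K) : PGFlag n K where
  spaces := {W | ∃ U ∈ F.spaces, W = U.map g.toLinearMap}
  incident := by
    rintro _ ⟨U, hU, rfl⟩ _ ⟨W, hW, rfl⟩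
    exact (F.incident U hU W hW).imp (fun h => Submodule.map_mono h)
      (fun h => Submodule.map_mono h)
  ne_bot := by
    rintro _ ⟨U, hU, rfl⟩ h
    exact F.ne_bot U hU ((Submodule.map_eq_bot_iff (p := U) (e := g)).mp h)
  ne_top := by
    rintro _ ⟨U, hU, rfl⟩ h
    refine F.ne_top U hU ?_
    rw [eq_top_iff]
    intro x _
    have hx : g x ∈ U.map g.toLinearMap := by rw [h]; trivial
    obtain ⟨y, hy, hxy⟩ := hx
    rwa [← g.injective hxy]

/-- The span `⟨e_1, …, e_k⟩` of the first `k` standard basis vectors. -/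
def standardSpace (n : ℕ) (K : Type*) [Field K] (k : ℕ) : Submodule K (PGSpace n K) :=
  Submodule.span K {v | ∃ j : Fin (n + 1), (j : ℕ) < k ∧ v = Pi.single j 1}

theorem standardSpace_mono {k l : ℕ} (h : k ≤ l) :
    standardSpace n K k ≤ standardSpace n K l := by
  apply Submodule.span_mono
  rintro v ⟨j, hj, rfl⟩
  exact ⟨j, lt_of_lt_of_le hj h, rfl⟩

/-- The standard maximal flag `⟨e_1⟩ ⊂ ⟨e_1, e_2⟩ ⊂ … ⊂ ⟨e_1, …, e_n⟩`, whose stabilizer is the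
subgroup `B` of the standard BN-pair. -/
def standard (n : ℕ) (K : Type*) [Field K] : PGFlag n K where
  spaces := {U | ∃ k, 1 ≤ k ∧ k ≤ n ∧ U = standardSpace n K k}
  incident := by
    rintro _ ⟨k, -, -, rfl⟩ _ ⟨l, -, -, rfl⟩
    exact (le_total k l).imp (fun h => standardSpace_mono h) (fun h => standardSpace_mono h)
  ne_bot := by
    rintro _ ⟨k, hk, -, rfl⟩ h
    have h0 : (Pi.single 0 1 : PGSpace n K) ∈ standardSpace n K k :=
      Submodule.subset_span ⟨0, lt_of_lt_of_le Nat.zero_lt_one hk, rfl⟩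
    rw [h, Submodule.mem_bot] at h0
    simpa using congrFun h0 0
  ne_top := by
    rintro _ ⟨k, -, hk, rfl⟩ h
    have hle : standardSpace n K k ≤
        LinearMap.ker (LinearMap.proj (R := K) (φ := fun _ : Fin (n + 1) => K) (Fin.last n)) := by
      refine Submodule.span_le.mpr ?_
      rintro v ⟨j, hj, rfl⟩
      have hne : Fin.last n ≠ j := by
        rintro rfl
        simp at hj
        omega
      simp [hne]
    have hl : (Pi.single (Fin.last n) 1 : PGSpace n K) ∈ standardSpace n K k := by
      rw [h]; trivial
    simpa using hle hl

/-- The linear map of a permutation `w` of the coordinates: `e_i ↦ e_{w i}`. -/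
def permLin (n : ℕ) (K : Type*) [Field K] (w : Equiv.Perm (Fin (n + 1))) :
    PGSpace n K ≃ₗ[K] PGSpace n K :=
  LinearEquiv.funCongrLeft K K w.symm

/-- The longest element of the Weyl group `Sym(n+1)`, the order-reversing permutation
`(1, n+1)(2, n)(3, n-1)⋯`. -/
def longest (n : ℕ) : Equiv.Perm (Fin (n + 1)) := Fin.revPerm

/-- The opposition relation on maximal flags: with `F₀ = B` the standard flag, the orbital
`{(h B, h w₀ B) | h ∈ G}` of the action of the linear group on maximal flags. -/
def MaxOpposite (F F' : PGFlag n K) : Prop :=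
  ∃ h : PGSpace n K ≃ₗ[K] PGSpace n K,
    F = (standard n K).map h ∧ F' = ((standard n K).map (permLin n K (longest n))).map h

/-- The action of `w₀` on types: conjugation by `w₀` maps the generator `s_k = (k, k+1)` to
`s_{n+1-k}`. -/
def oppositeType (n : ℕ) (J : Set ℕ) : Set ℕ :=
  {k | ∃ j ∈ J, k + j = n + 1}

/-- Two flags are opposite if `w₀` maps the type of one to the type of the other and they can be
extended to two opposite maximal flags. -/
def Opposite (F F' : PGFlag n K) : Prop :=
  oppositeType n F.type = F'.type ∧
    ∃ M M' : PGFlag n K, F.spaces ⊆ M.spaces ∧ F'.spaces ⊆ M'.spaces ∧ MaxOpposite M M'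

/-- The set of all flags of type `J`. -/
def ofType (n : ℕ) (K : Type*) [Field K] (J : Set ℕ) : Set (PGFlag n K) :=
  {F | F.type = J}

/-- An EKR-set of flags of (self-opposite) type `J`: a set of flags of type `J`, no two of which
are opposite. -/
def IsEKRSet (J : Set ℕ) (C : Set (PGFlag n K)) : Prop :=
  oppositeType n J = J ∧ C ⊆ ofType n K J ∧ ∀ F ∈ C, ∀ F' ∈ C, ¬ Opposite F F'

/-- The upper bound `v / (1 + q^((n+1)/2))`, with `v` the number of flags of type `J` and `q` the
order of the field. -/
noncomputable def ekrBound (n : ℕ) (K : Type*) [Field K] (J : Set ℕ) : ℝ :=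
  ((ofType n K J).ncard : ℝ) / (1 + (Nat.card K : ℝ) ^ (((n : ℝ) + 1) / 2))

/-- All flags of type `J` whose `m`-dimensional space contains the subspace `P`. -/
def through (J : Set ℕ) (m : ℕ) (P : Submodule K (PGSpace n K)) : Set (PGFlag n K) :=
  {F | F.type = J ∧ ∃ U ∈ F.spaces, Module.finrank K U = m ∧ P ≤ U}

/-- All flags of type `J` whose `m`-dimensional space is contained in the subspace `H`. -/
def inside (J : Set ℕ) (m : ℕ) (H : Submodule K (PGSpace n K)) : Set (PGFlag n K) :=
  {F | F.type = J ∧ ∃ U ∈ F.spaces, Module.finrank K U = m ∧ U ≤ H}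

end PGFlag

open Module

/-! Middle members of opposite flags are complementary (`Opposite.isCompl`), so they share no point
and lie in no common hyperplane; hence `C` is an EKR-set. For the size in case (i), count pairs of a
nonzero vector and a flag of type `J` whose `m`-space contains it. Each flag gives `q ^ m - 1`
pairs. Since the linear group is transitive on points, each of the `q ^ (2 * m) - 1` vectors gives
`|C|` pairs, and the quotient is `q ^ m + 1`. Case (ii) is the same count in the dual space, with
annihilators of the `m`-spaces, again of dimension `m`. -/

/-- If each member of a finite family is assigned an `m`-dimensional subspace of a `2m`-dimensional
space, and every nonzero vector lies in the same number `c` of them, then the family has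
`c * (q ^ m + 1)` members. -/
theorem card_eq_mul_of_forall_ncard_mem {K W α : Type*} [Field K] [Finite K] [AddCommGroup W]
    [Module K W] [Module.Finite K W] {m c : ℕ} (hm : 1 ≤ m) (hW : finrank K W = 2 * m) [Finite α]
    (s : Set α) (S : α → Submodule K W) (hS : ∀ a ∈ s, finrank K (S a) = m)
    (hc : ∀ w : W, w ≠ 0 → {a | a ∈ s ∧ w ∈ S a}.ncard = c) :
    c * (Nat.card K ^ m + 1) = s.ncard := by
  classical
  have : Finite W := Module.finite_of_finite K
  have := Fintype.ofFinite W
  have := Fintype.ofFinite α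
  have hcount := Finset.card_mul_eq_card_mul (s := ({0}ᶜ : Finset W)) (t := s.toFinset)
    (fun w a => w ∈ S a) (m := c) (n := Nat.card K ^ m - 1)
    (fun w hw => by
      rw [← hc w (by simpa using hw), Set.ncard_eq_toFinset_card']
      congr 1
      ext a
      simp [Finset.bipartiteAbove])
    (fun a ha => by
      have h : (({0}ᶜ : Finset W).bipartiteBelow (fun w a => w ∈ S a) a)
          = (S a : Set W).toFinset.erase 0 := by
        ext w
        simp [Finset.bipartiteBelow]
      rw [h, Finset.card_erase_of_mem (by simp), ← Set.ncard_eq_toFinset_card',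
        ← hS a (by simpa using ha), ← Module.natCard_eq_pow_finrank, ← Nat.card_coe_set_eq]
      rfl)
  rw [Finset.card_compl, Finset.card_singleton, ← Nat.card_eq_fintype_card,
    Module.natCard_eq_pow_finrank (K := K), hW, ← Set.ncard_eq_toFinset_card'] at hcount
  have hq : 1 < Nat.card K := Finite.one_lt_card
  have hqm : 1 < Nat.card K ^ m := Nat.one_lt_pow (by omega) hq
  -- Writing `q ^ m = 1 + r + 1` removes the truncated subtraction.
  obtain ⟨r, hr⟩ := Nat.exists_eq_add_of_lt hqm
  have h2 : Nat.card K ^ (2 * m) - 1 = (Nat.card K ^ m + 1) * (Nat.card K ^ m - 1) := by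
    rw [mul_comm 2 m, pow_mul, hr]
    have : (1 + r + 1) ^ 2 = (1 + r + 1 + 1) * (1 + r) + 1 := by ring
    simp [this]
  rw [h2] at hcount
  refine Nat.eq_of_mul_eq_mul_right (Nat.sub_pos_of_lt hqm) ?_
  rw [← hcount]
  ring

/-- Any isomorphism `P ≃ Q` extends to `V`: the linear group is transitive on subspaces of a given
dimension. -/
theorem Submodule.exists_linearEquiv_map_eq {K V : Type*} [Field K] [AddCommGroup V] [Module K V]
    [Module.Finite K V] {P Q : Submodule K V} (h : finrank K P = finrank K Q) :
    ∃ g : V ≃ₗ[K] V, P.map g.toLinearMap = Q := by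
  obtain ⟨g, hg⟩ := Submodule.exists_linearEquiv_restrict_eq (LinearEquiv.ofFinrankEq P Q h)
  refine ⟨g, Submodule.eq_of_le_of_finrank_eq ?_ ?_⟩
  · rintro _ ⟨x, hx, rfl⟩
    have := hg ⟨x, hx⟩
    simp only [LinearEquiv.coe_coe]
    rw [← this]
    exact Subtype.coe_prop _
  · exact (LinearEquiv.finrank_map_eq g P).trans h

namespace PGFlag

variable {n : ℕ} {K : Type*} [Field K]

instance [Finite K] : Finite (PGFlag n K) :=
  Finite.of_injective (β := Set (Submodule K (PGSpace n K))) spaces fun _ _ => PGFlag.ext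

theorem eq_of_finrank_eq (F : PGFlag n K) {U W : Submodule K (PGSpace n K)} (hU : U ∈ F.spaces)
    (hW : W ∈ F.spaces) (h : finrank K U = finrank K W) : U = W :=
  (F.incident U hU W hW).elim (fun hle => Submodule.eq_of_le_of_finrank_eq hle h)
    (fun hle => (Submodule.eq_of_le_of_finrank_eq hle h.symm).symm)

/-- The `m`-dimensional member of a flag (`⊥` if there is none). -/
noncomputable def member (F : PGFlag n K) (m : ℕ) : Submodule K (PGSpace n K) :=
  sSup {U | U ∈ F.spaces ∧ finrank K U = m}

theorem member_eq (F : PGFlag n K) {U : Submodule K (PGSpace n K)} (hU : U ∈ F.spaces) :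
    F.member (finrank K U) = U := by
  have : {W | W ∈ F.spaces ∧ finrank K W = finrank K U} = {U} := by
    ext W
    constructor
    · rintro ⟨hW, h⟩
      exact F.eq_of_finrank_eq hW hU h
    · rintro rfl
      exact ⟨hU, rfl⟩
  rw [member, this, sSup_singleton]

theorem finrank_member {F : PGFlag n K} {m : ℕ} (hm : m ∈ F.type) :
    finrank K (F.member m) = m := by
  obtain ⟨U, hU, rfl⟩ := hm
  rw [F.member_eq hU]

/-- Turns the existential conditions in `through` and `inside` into conditions on a function of the
flag, as the double count requires. -/
theorem exists_mem_and_iff_member {F : PGFlag n K} {m : ℕ} (hm : m ∈ F.type)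
    (p : Submodule K (PGSpace n K) → Prop) :
    (∃ U ∈ F.spaces, finrank K U = m ∧ p U) ↔ p (F.member m) := by
  constructor
  · rintro ⟨U, hU, rfl, h⟩
    rwa [F.member_eq hU]
  · intro h
    obtain ⟨U, hU, rfl⟩ := hm
    rw [F.member_eq hU] at h
    exact ⟨U, hU, rfl, h⟩

theorem through_eq {J : Set ℕ} {m : ℕ} (hm : m ∈ J) (P : Submodule K (PGSpace n K)) :
    through J m P = {F | F ∈ ofType n K J ∧ P ≤ F.member m} := by
  ext F
  exact and_congr_right fun hF => exists_mem_and_iff_member (hF ▸ hm) fun U => P ≤ U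

theorem inside_eq {J : Set ℕ} {m : ℕ} (hm : m ∈ J) (H : Submodule K (PGSpace n K)) :
    inside J m H = {F | F ∈ ofType n K J ∧ F.member m ≤ H} := by
  ext F
  exact and_congr_right fun hF => exists_mem_and_iff_member (hF ▸ hm) fun U => U ≤ H

theorem type_map (g : PGSpace n K ≃ₗ[K] PGSpace n K) (F : PGFlag n K) :
    (F.map g).type = F.type := by
  ext k
  constructor
  · rintro ⟨_, ⟨U, hU, rfl⟩, rfl⟩
    exact ⟨U, hU, (LinearEquiv.finrank_map_eq g U).symm⟩
  · rintro ⟨U, hU, rfl⟩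
    exact ⟨_, ⟨U, hU, rfl⟩, LinearEquiv.finrank_map_eq g U⟩

theorem map_injective (g : PGSpace n K ≃ₗ[K] PGSpace n K) :
    Function.Injective (map g : PGFlag n K → PGFlag n K) := by
  intro F F' h
  have key : ∀ F : PGFlag n K, F.spaces = {U | U.map g.toLinearMap ∈ (F.map g).spaces} := by
    intro F
    ext U
    constructor
    · intro hU
      exact ⟨U, hU, rfl⟩
    · rintro ⟨W, hW, h⟩
      rwa [Submodule.map_injective_of_injective (f := g.toLinearMap) g.injective h]
  ext1
  rw [key F, key F', h]

/-- An automorphism taking `P` to `Q` acts injectively on flags. Exchanging `P` and `Q` gives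
equality. -/
theorem ncard_through_le [Finite K] {J : Set ℕ} {m : ℕ} {P Q : Submodule K (PGSpace n K)}
    (h : finrank K P = finrank K Q) : (through J m P).ncard ≤ (through J m Q).ncard := by
  obtain ⟨g, rfl⟩ := Submodule.exists_linearEquiv_map_eq h
  refine Set.ncard_le_ncard_of_injOn (map g) ?_ (map_injective g).injOn
  rintro F ⟨hF, U, hU, hd, hPU⟩
  exact ⟨(type_map g F).trans hF, _, ⟨U, hU, rfl⟩, (LinearEquiv.finrank_map_eq g U).trans hd,
    Submodule.map_mono hPU⟩

theorem ncard_inside_le [Finite K] {J : Set ℕ} {m : ℕ} {P Q : Submodule K (PGSpace n K)}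
    (h : finrank K P = finrank K Q) : (inside J m P).ncard ≤ (inside J m Q).ncard := by
  obtain ⟨g, rfl⟩ := Submodule.exists_linearEquiv_map_eq h
  refine Set.ncard_le_ncard_of_injOn (map g) ?_ (map_injective g).injOn
  rintro F ⟨hF, U, hU, hd, hUP⟩
  exact ⟨(type_map g F).trans hF, _, ⟨U, hU, rfl⟩, (LinearEquiv.finrank_map_eq g U).trans hd,
    Submodule.map_mono hUP⟩

theorem ncard_through_mul [Finite K] {J : Set ℕ} {m : ℕ} (hm1 : 1 ≤ m) (hn : n + 1 = 2 * m)
    (hm : m ∈ J) {P : Submodule K (PGSpace n K)} (hP : finrank K P = 1) :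
    (through J m P).ncard * (Nat.card K ^ m + 1) = (ofType n K J).ncard := by
  refine card_eq_mul_of_forall_ncard_mem (K := K) (W := PGSpace n K) hm1 (by simpa using hn) _
    (fun F => F.member m) (fun F hF => finrank_member (by rwa [show F.type = J from hF])) ?_
  intro w hw
  have hd : finrank K (K ∙ w) = finrank K P := by rw [finrank_span_singleton hw, hP]
  rw [← (ncard_through_le hd).antisymm (ncard_through_le hd.symm), through_eq hm]
  simp only [Submodule.span_singleton_le_iff_mem]

theorem ncard_inside_mul [Finite K] {J : Set ℕ} {m : ℕ} (hm1 : 1 ≤ m) (hn : n + 1 = 2 * m)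
    (hm : m ∈ J) {H : Submodule K (PGSpace n K)} (hH : finrank K H = n) :
    (inside J m H).ncard * (Nat.card K ^ m + 1) = (ofType n K J).ncard := by
  have hV : finrank K (PGSpace n K) = n + 1 := by simp
  refine card_eq_mul_of_forall_ncard_mem (K := K) (W := Dual K (PGSpace n K)) hm1
    (by rw [Subspace.dual_finrank_eq, hV, hn]) _ (fun F => (F.member m).dualAnnihilator) ?_ ?_
  · intro F hF
    have h1 := finrank_member (F := F) (m := m) (by rwa [show F.type = J from hF])
    have h2 := Subspace.finrank_add_finrank_dualAnnihilator_eq (F.member m)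
    omega
  · intro f hf
    -- A nonzero functional `f` stands for the hyperplane `ker f`, and `f` annihilates the `m`-space
    -- iff that space lies in `ker f`.
    have hd : finrank K (LinearMap.ker f) = finrank K H := by
      have := Module.Dual.finrank_ker_add_one_of_ne_zero hf
      omega
    rw [← (ncard_inside_le hd).antisymm (ncard_inside_le hd.symm), inside_eq hm]
    simp only [Submodule.mem_dualAnnihilator, SetLike.le_def, LinearMap.mem_ker]

theorem finrank_standardSpace {k : ℕ} (hk : k ≤ n + 1) : finrank K (standardSpace n K k) = k := by
  have hli := (Pi.basisFun K (Fin (n + 1))).linearIndependent.comp (Fin.castLE hk)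
    (Fin.castLE_injective hk)
  have hspan : standardSpace n K k
      = Submodule.span K (Set.range (Pi.basisFun K (Fin (n + 1)) ∘ Fin.castLE hk)) := by
    unfold standardSpace
    congr 1
    ext v
    constructor
    · rintro ⟨j, hj, rfl⟩
      exact ⟨⟨j, hj⟩, by simp⟩
    · rintro ⟨j, rfl⟩
      exact ⟨Fin.castLE hk j, j.2, by simp⟩
  rw [hspan, finrank_span_eq_card hli, Fintype.card_fin]

theorem apply_eq_zero_of_mem_standardSpace {k : ℕ} {x : PGSpace n K}
    (hx : x ∈ standardSpace n K k) {i : Fin (n + 1)} (hi : k ≤ i) : x i = 0 := by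
  have hle : standardSpace n K k ≤
      LinearMap.ker (LinearMap.proj (R := K) (φ := fun _ : Fin (n + 1) => K) i) := by
    refine Submodule.span_le.mpr ?_
    rintro v ⟨j, hj, rfl⟩
    have hne : i ≠ j := by
      rintro rfl
      omega
    simp [hne]
  simpa using hle hx

theorem disjoint_standardSpace_map_longest {m : ℕ} (hn : n + 1 = 2 * m) :
    Disjoint (standardSpace n K m)
      ((standardSpace n K m).map (permLin n K (longest n)).toLinearMap) := by
  rw [Submodule.disjoint_def]
  rintro _ hx ⟨y, hy, rfl⟩
  ext i
  by_cases hi : m ≤ i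
  · exact apply_eq_zero_of_mem_standardSpace hx hi
  -- Coordinate `i` of the image is coordinate `2 * m - 1 - i` of `y`, which is at least `m` when `i
  -- < m`.
  · refine apply_eq_zero_of_mem_standardSpace (i := Fin.rev i) hy ?_
    rw [Fin.val_rev]
    omega

/-- In odd projective dimension the middle-dimensional members of opposite flags are
complementary. -/
theorem Opposite.isCompl {m : ℕ} (hn : n + 1 = 2 * m) {F F' : PGFlag n K} (h : Opposite F F')
    {U U' : Submodule K (PGSpace n K)} (hU : U ∈ F.spaces) (hU' : U' ∈ F'.spaces)
    (hd : finrank K U = m) (hd' : finrank K U' = m) : IsCompl U U' := by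
  obtain ⟨-, M, M', hFM, hFM', g, rfl, rfl⟩ := h
  obtain ⟨_, ⟨k, -, hk, rfl⟩, rfl⟩ := hFM hU
  obtain ⟨_, ⟨_, ⟨k', -, hk', rfl⟩, rfl⟩, rfl⟩ := hFM' hU'
  -- Dimension forces both indices in the maximal flags to be `m`.
  have e : k = m := by
    rw [← hd, LinearEquiv.finrank_map_eq, finrank_standardSpace (by omega)]
  have e' : k' = m := by
    rw [← hd', LinearEquiv.finrank_map_eq, LinearEquiv.finrank_map_eq,
      finrank_standardSpace (by omega)]
  subst e e'
  refine Submodule.isCompl_iff_disjoint _ _ ?_ |>.mpr ?_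
  · rw [hd, hd']
    simp
    omega
  · exact Submodule.disjoint_map g.injective (disjoint_standardSpace_map_longest hn)

end PGFlag

theorem mainTheorem8 {K : Type*} [Field K] [Finite K] (n m : ℕ) (hn : (n : ℤ) = 2 * m - 1)
    (J : Set ℕ) (hJ : J ⊆ Set.Icc 1 n) (hJop : PGFlag.oppositeType n J = J) (hm : m ∈ J)
    (C : Set (PGFlag n K))
    (hC : (∃ P : Submodule K (PGSpace n K),
              Module.finrank K P = 1 ∧ C = PGFlag.through J m P) ∨
          (∃ H : Submodule K (PGSpace n K),
              Module.finrank K H = n ∧ C = PGFlag.inside J m H)) :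
    PGFlag.IsEKRSet J C ∧ (C.ncard : ℝ) = PGFlag.ekrBound n K J := by
  have hn' : n + 1 = 2 * m := by omega
  have hm1 : 1 ≤ m := (hJ hm).1
  have hbound : C.ncard * (Nat.card K ^ m + 1) = (PGFlag.ofType n K J).ncard →
      (C.ncard : ℝ) = PGFlag.ekrBound n K J := by
    intro h
    have he : ((n : ℝ) + 1) / 2 = m := by
      have : (n : ℝ) + 1 = 2 * m := by exact_mod_cast hn'
      rw [this]
      ring
    rw [PGFlag.ekrBound, he, Real.rpow_natCast, ← h, eq_div_iff (by positivity)]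
    push_cast
    ring
  rcases hC with ⟨P, hP, rfl⟩ | ⟨H, hH, rfl⟩
  · refine ⟨⟨hJop, fun F hF => hF.1, ?_⟩, hbound (PGFlag.ncard_through_mul hm1 hn' hm hP)⟩
    rintro F ⟨-, U, hU, hd, hPU⟩ F' ⟨-, U', hU', hd', hPU'⟩ hop
    have hbot : P = ⊥ := le_bot_iff.mp ((hop.isCompl hn' hU hU' hd hd').disjoint hPU hPU')
    subst hbot
    simp at hP
  · refine ⟨⟨hJop, fun F hF => hF.1, ?_⟩, hbound (PGFlag.ncard_inside_mul hm1 hn' hm hH)⟩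
    rintro F ⟨-, U, hU, hd, hUH⟩ F' ⟨-, U', hU', hd', hUH'⟩ hop
    have htop : H = ⊤ := top_le_iff.mp ((hop.isCompl hn' hU hU' hd hd').codisjoint hUH hUH')
    subst htop
    simp at hH
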